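/- Let $n\ge 0$ and identify $M_2(\mathbb C)^{\otimes n}$ with the algebra of complex $2^n\times 2^n$ matrices. For $A\in M_2(\mathbb C)^{\otimes n}$ let $|A|=(A^*A)^{1/2}$ and let $\|A\|_1=2^{-n}\operatorname{tr}|A|$ be the normalized Schatten $1$-norm. For $1\le j\le n$ let $$d_j=\mathbb I^{\otimes(j-1)}\otimes\left(\mathbb I-\tfrac12\operatorname{tr}(\cdot)\mathbf 1\right)\otimes\mathbb I^{\otimes(n-j)},$$ where $\mathbb I$ is the identity map on $M_2(\mathbb C)$, put $\mathcal L=\sum_{j=1}^n d_j$, and define the carré du champ operator $\Gamma$ by $2\Gamma(A)=\mathcal L(A^*)A+A^*\mathcal L(A)-\mathcal L(A^*A)$. Then for every $A\in M_2(\mathbb C)^{\otimes n}$ the matrix $\Gamma(A)$ is positive semidefinite, and $$\|A-2^{-n}\operatorname{tr}(A)\mathbf 1\|_1\le \pi\left\|\Big(\sum_{j=1}^n d_j(A)^*d_j(A)\Big)^{1/2}\right\|_1\le\sqrt2\,\pi\,\big\|\Gamma(A)^{1/2}\big\|_1 .$$ Moreover, the first inequality strengthens the $L^1$-Poincaré inequality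 $\|A-2^{-n}\operatorname{tr}(A)\mathbf 1\|_1\le\pi\sum_{j=1}^n\|d_j(A)\|_1$, in the sense that $$\pi\left\|\Big(\sum_{j=1}^n d_j(A)^*d_j(A)\Big)^{1/2}\right\|_1\le\pi\sum_{j=1}^n\|d_j(A)\|_1 .$$ -/

import Mathlib

open scoped MatrixOrder ComplexOrder

noncomputable section

namespace QubitAlgebra

/-- The algebra `M₂(ℂ)^{⊗ n}`, realised as the matrices on `(ℂ²)^{⊗ n}` with rows and columns
indexed by bit strings of length `n`. -/
abbrev Alg (n : ℕ) : Type := Matrix (Fin n → Fin 2) (Fin n → Fin 2) ℂ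

/-- The elementary tensor `A₁ ⊗ ⋯ ⊗ Aₙ` (iterated Kronecker product). -/
def tensor {n : ℕ} (A : Fin n → Matrix (Fin 2) (Fin 2) ℂ) : Alg n :=
  Matrix.of fun x y => ∏ i, A i (x i) (y i)

/-- The single-qubit map `𝕀 - ½ tr : X ↦ X - ½ tr(X) 1`. -/
def gen₀ : Matrix (Fin 2) (Fin 2) ℂ →ₗ[ℂ] Matrix (Fin 2) (Fin 2) ℂ where
  toFun X := X - (2⁻¹ * X.trace) • (1 : Matrix (Fin 2) (Fin 2) ℂ)
  map_add' X Y := by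
    simp only [Matrix.trace_add, mul_add, add_smul]
    abel
  map_smul' c X := by
    simp only [Matrix.trace_smul, smul_eq_mul, RingHom.id_apply, smul_sub, smul_smul]
    congr 2
    ring

/-- The map `d_j = 𝕀^{⊗ (j-1)} ⊗ (𝕀 - ½ tr) ⊗ 𝕀^{⊗ (n-j)}` on `M₂(ℂ)^{⊗ n}`, in matrix entries:
one subtracts from `A` the partial average `½ tr_j(A)` over the `j`-th qubit.
See `d_tensor` and `eq_d_of_tensor`. -/
def d {n : ℕ} (j : Fin n) : Alg n →ₗ[ℂ] Alg n where
  toFun A := Matrix.of fun x y =>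
    A x y - if x j = y j then
      2⁻¹ * ∑ a : Fin 2, A (Function.update x j a) (Function.update y j a) else 0
  map_add' A B := by
    ext x y
    by_cases h : x j = y j
    · simp [h]
      ring
    · simp [h]
  map_smul' c A := by
    ext x y
    by_cases h : x j = y j
    · simp [h]
      ring
    · simp [h]

/-- `d_j` acts on elementary tensors by applying `𝕀 - ½ tr` to the `j`-th factor. -/
theorem d_tensor {n : ℕ} (j : Fin n) (A : Fin n → Matrix (Fin 2) (Fin 2) ℂ) :
    d j (tensor A) = tensor (Function.update A j (gen₀ (A j))) := by
  have key : ∀ (B : Fin n → Matrix (Fin 2) (Fin 2) ℂ) (x y : Fin n → Fin 2),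
      (∏ i, B i (x i) (y i)) =
        B j (x j) (y j) * ∏ i ∈ Finset.univ.erase j, B i (x i) (y i) := by
    intro B x y
    exact (Finset.mul_prod_erase _ _ (Finset.mem_univ j)).symm
  ext x y
  have h1 : ∀ a : Fin 2, (∏ i ∈ Finset.univ.erase j,
      A i (Function.update x j a i) (Function.update y j a i)) =
      ∏ i ∈ Finset.univ.erase j, A i (x i) (y i) := by
    intro a
    refine Finset.prod_congr rfl fun i hi => ?_
    simp [Function.update_of_ne (Finset.ne_of_mem_erase hi)]
  have h2 : (∏ i ∈ Finset.univ.erase j,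
      (Function.update A j (gen₀ (A j))) i (x i) (y i)) =
      ∏ i ∈ Finset.univ.erase j, A i (x i) (y i) := by
    refine Finset.prod_congr rfl fun i hi => ?_
    rw [Function.update_of_ne (Finset.ne_of_mem_erase hi)]
  simp only [d, tensor, LinearMap.coe_mk, AddHom.coe_mk, Matrix.of_apply]
  rw [key A x y, key (Function.update A j (gen₀ (A j))) x y, h2]
  simp only [key A (Function.update x j _), h1, Function.update_self]
  by_cases h : x j = y j
  · simp [h, gen₀, Matrix.trace, Matrix.sub_apply]
    ring
  · simp [h, gen₀, Matrix.sub_apply]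

/-- Elementary tensors span, so `d_tensor` characterises `d_j`. -/
theorem eq_d_of_tensor {n : ℕ} (j : Fin n) (T : Alg n →ₗ[ℂ] Alg n)
    (hT : ∀ A, T (tensor A) = tensor (Function.update A j (gen₀ (A j)))) : T = d j := by
  refine Matrix.ext_linearMap ℂ fun x y => ?_
  refine LinearMap.ext_ring ?_
  have hs : (Matrix.single x y 1 : Alg n) =
      tensor fun i => Matrix.single (x i) (y i) 1 := by
    ext u v
    simp only [tensor, Matrix.of_apply, Matrix.single_apply, Finset.prod_ite_zero,
      Finset.prod_const_one, Finset.mem_univ, true_imp_iff]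
    congr 1
    simp only [funext_iff, forall_and]
  change T (Matrix.single x y 1) = d j (Matrix.single x y 1)
  rw [hs, hT, d_tensor]

/-- The generator `𝓛 = ∑ⱼ d_j` of the depolarizing semigroup `P_t = exp(-t 𝓛)`. -/
def gen (n : ℕ) : Alg n →ₗ[ℂ] Alg n := ∑ j, d j

/-- The carré du champ operator,
`2 Γ(A) = 𝓛(A⋆) A + A⋆ 𝓛(A) - 𝓛(A⋆ A)`. -/
def carreDuChamp {n : ℕ} (A : Alg n) : Alg n :=
  (2⁻¹ : ℂ) • (gen n (star A) * A + star A * gen n A - gen n (star A * A))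

/-- The normalized Schatten 1-norm `‖A‖₁ = 2⁻ⁿ tr |A|`, where `|A| = (A⋆ A)^{1/2}`. -/
def norm₁ {n : ℕ} (A : Alg n) : ℝ :=
  (2 ^ n : ℝ)⁻¹ * (Matrix.trace (CFC.sqrt (star A * A))).re

/-- The square function `(∑ⱼ d_j(A)⋆ d_j(A))^{1/2}`. -/
def squareFun {n : ℕ} (A : Alg n) : Alg n :=
  CFC.sqrt (∑ j, star (d j A) * d j A)

/-- The total `L¹`-influence `Inf¹(A) = ∑ⱼ ‖d_j A‖₁`. -/
def totalInfluence₁ {n : ℕ} (A : Alg n) : ℝ := ∑ j, norm₁ (d j A)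

end QubitAlgebra

end

open scoped MatrixOrder ComplexOrder

noncomputable section

namespace QubitAlgebra

/-! ### Trace duality and Bessel's inequality for columns of matrices. -/

section TraceDuality

variable {m ι κ : Type*} [Fintype m] [Fintype ι] [Fintype κ]

/-! The depolarizing channel on each qubit has Kraus operators `amp t k • pauli k`. Its `n`-fold
tensor power moves from the identity at `t = 0` to the normalized trace at `t = π/3`. Pair it with
`A` and differentiate: the `j`-th partial derivative takes values in the range of `d j`, so `d j`
passes to `A` and the derivative is twice the pairing of `(d j A)` with a column of channel
derivatives. Since `amp t` and `ampDeriv t` are orthonormal, Bessel makes that column a contraction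
(`sum_star_pauliChannel_mul_le`), and `norm_sum_trace_le` bounds the pairing by the trace of
`squareFun A`. Integrating over an interval of length `π/3` and dualizing gives the constant `2π/3 ≤
π`.

For `Γ`, `d j A` is an average of differences `A - P A P⋆` and the `j`-th summand of `2Γ(A)` is the
average of their squares; convexity and operator monotonicity of the square root conclude. The
comparison with the total influence is trace duality again. -/

theorem sum_star_mul_self_nonneg (B : ι → Matrix m m ℂ) : 0 ≤ ∑ j, star (B j) * B j :=
  Finset.sum_nonneg fun j _ => star_mul_self_nonneg (B j)

variable [DecidableEq m]

/-- A positive semidefinite matrix is unitarily diagonalisable with nonnegative eigenvalues. -/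
theorem exists_unitary_diagonal {M : Matrix m m ℂ} (hM : 0 ≤ M) :
    ∃ (U : Matrix m m ℂ) (l : m → ℝ), star U * U = 1 ∧ U * star U = 1 ∧ (∀ i, 0 ≤ l i) ∧
      M = U * Matrix.diagonal (fun i => (l i : ℂ)) * star U := by
  have hp := Matrix.nonneg_iff_posSemidef.mp hM
  refine ⟨hp.isHermitian.eigenvectorUnitary, hp.isHermitian.eigenvalues,
    Unitary.coe_star_mul_self _, Unitary.coe_mul_star_self _, hp.eigenvalues_nonneg, ?_⟩
  have := hp.isHermitian.spectral_theorem
  rw [Unitary.conjStarAlgAut_apply] at this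
  exact this

theorem conj_diagonal_mul {U : Matrix m m ℂ} (hU : star U * U = 1) (a b : m → ℂ) :
    (U * Matrix.diagonal a * star U) * (U * Matrix.diagonal b * star U) =
      U * Matrix.diagonal (fun i => a i * b i) * star U := by
  rw [← Matrix.diagonal_mul_diagonal]
  calc _ = U * Matrix.diagonal a * (star U * U) * Matrix.diagonal b * star U := by
        simp only [mul_assoc]
    _ = _ := by rw [hU]; simp only [mul_assoc, one_mul]

theorem conj_diagonal_nonneg (U : Matrix m m ℂ) {l : m → ℝ} (hl : ∀ i, 0 ≤ l i) :
    0 ≤ U * Matrix.diagonal (fun i => (l i : ℂ)) * star U := by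
  refine star_right_conjugate_nonneg ?_ U
  rw [Matrix.nonneg_iff_posSemidef, Matrix.posSemidef_diagonal_iff]
  exact fun i => by exact_mod_cast hl i

theorem sqrt_conj_diagonal {U : Matrix m m ℂ} (hU : star U * U = 1) {l : m → ℝ}
    (hl : ∀ i, 0 ≤ l i) :
    CFC.sqrt (U * Matrix.diagonal (fun i => (l i : ℂ)) * star U) =
      U * Matrix.diagonal (fun i => ((√(l i) : ℝ) : ℂ)) * star U := by
  refine CFC.sqrt_unique ?_ (conj_diagonal_nonneg U fun i => Real.sqrt_nonneg _)
  rw [conj_diagonal_mul hU]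
  congr 3
  funext i
  rw [← Complex.ofReal_mul, Real.mul_self_sqrt (hl i)]

theorem trace_conj {U : Matrix m m ℂ} (hU : star U * U = 1) (X : Matrix m m ℂ) :
    (U * X * star U).trace = X.trace := by
  rw [Matrix.trace_mul_comm, ← mul_assoc, hU, one_mul]

/-- Trace duality: pairing a column with a column contraction is bounded by the trace norm of
its absolute value. -/
theorem norm_sum_trace_le (B C : ι → Matrix m m ℂ) (hC : ∑ j, star (C j) * C j ≤ 1) :
    ‖∑ j, (star (B j) * C j).trace‖ ≤ (CFC.sqrt (∑ j, star (B j) * B j)).trace.re := by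
  obtain ⟨U, l, hU, hU', hl, hM⟩ := exists_unitary_diagonal (sum_star_mul_self_nonneg B)
  have hdiag (X Y : ι → Matrix m m ℂ) (i : m) :
      (star U * (∑ j, star (X j) * Y j) * U) i i =
        ∑ p : ι × m, star ((X p.1 * U) p.2 i) * (Y p.1 * U) p.2 i := by
    have h : star U * (∑ j, star (X j) * Y j) * U = ∑ j, star (X j * U) * (Y j * U) := by
      rw [Finset.mul_sum, Finset.sum_mul]
      exact Finset.sum_congr rfl fun j _ => by simp only [star_mul, mul_assoc]
    rw [h, Matrix.sum_apply, Fintype.sum_prod_type]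
    rfl
  -- Stacking the `i`-th columns of all `X j * U` turns diagonal entries in the eigenbasis into
  -- inner products, so Cauchy–Schwarz applies one eigenvector at a time.
  let vec (X : ι → Matrix m m ℂ) (i : m) : EuclideanSpace ℂ (ι × m) :=
    WithLp.toLp 2 fun p => (X p.1 * U) p.2 i
  have hvec (X Y : ι → Matrix m m ℂ) (i : m) :
      inner ℂ (vec X i) (vec Y i) = (star U * (∑ j, star (X j) * Y j) * U) i i := by
    rw [hdiag, PiLp.inner_apply]
    exact Finset.sum_congr rfl fun p _ => by simp [vec, mul_comm]
  have hnorm (X : ι → Matrix m m ℂ) (i : m) :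
      ‖vec X i‖ ^ 2 = ((star U * (∑ j, star (X j) * X j) * U) i i).re := by
    rw [← hvec, inner_self_eq_norm_sq_to_K]
    norm_cast
  have hB (i : m) : ‖vec B i‖ = √(l i) := by
    rw [← Real.sqrt_sq (norm_nonneg (vec B i)), hnorm, hM]
    have : star U * (U * Matrix.diagonal (fun i => (l i : ℂ)) * star U) * U =
        Matrix.diagonal (fun i => (l i : ℂ)) := by
      calc _ = (star U * U) * Matrix.diagonal (fun i => (l i : ℂ)) * (star U * U) := by
            simp only [mul_assoc]
        _ = _ := by rw [hU, one_mul, mul_one]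
    rw [this, Matrix.diagonal_apply_eq, Complex.ofReal_re]
  have hC1 (i : m) : ‖vec C i‖ ≤ 1 := by
    rw [← abs_of_nonneg (norm_nonneg (vec C i)), ← sq_le_one_iff_abs_le_one, hnorm]
    have h := Matrix.le_iff.mp (star_left_conjugate_le_conjugate hC U)
    have h2 := h.diag_nonneg (i := i)
    rw [mul_one, hU, Matrix.sub_apply, Matrix.one_apply_eq] at h2
    have h3 := (Complex.le_def.mp h2).1
    simp only [Complex.zero_re, Complex.sub_re, Complex.one_re] at h3
    linarith
  have htr : ∑ j, (star (B j) * C j).trace = ∑ i, inner ℂ (vec B i) (vec C i) := by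
    simp only [hvec]
    rw [← Matrix.trace_sum, ← trace_conj (U := star U) (by rwa [star_star]), star_star]
    rfl
  rw [htr, hM, sqrt_conj_diagonal hU hl, trace_conj hU, Matrix.trace_diagonal, Complex.re_sum]
  refine (norm_sum_le _ _).trans (Finset.sum_le_sum fun i _ => ?_)
  rw [Complex.ofReal_re, ← hB]
  exact (norm_inner_le_norm _ _).trans
    (mul_le_of_le_one_right (norm_nonneg _) (hC1 i))

/-- The bound of `norm_sum_trace_le` is attained, at the polar part of the column. -/
theorem exists_sum_trace_eq (B : ι → Matrix m m ℂ) :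
    ∃ C : ι → Matrix m m ℂ, ∑ j, star (C j) * C j ≤ 1 ∧
      ∑ j, (star (B j) * C j).trace = (CFC.sqrt (∑ j, star (B j) * B j)).trace := by
  obtain ⟨U, l, hU, hU', hl, hM⟩ := exists_unitary_diagonal (sum_star_mul_self_nonneg B)
  -- The inverse square root of `∑ j, star (B j) * B j` on its support: since `0⁻¹ = 0`, it vanishes
  -- on the kernel.
  set F : Matrix m m ℂ := U * Matrix.diagonal (fun i => (((√(l i))⁻¹ : ℝ) : ℂ)) * star U with hF
  have hFs : star F = F :=
    (conj_diagonal_nonneg U fun i => inv_nonneg.mpr (Real.sqrt_nonneg (l i))).isSelfAdjoint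
  have hMF : (∑ j, star (B j) * B j) * F = CFC.sqrt (∑ j, star (B j) * B j) := by
    rw [hM, sqrt_conj_diagonal hU hl, hF, conj_diagonal_mul hU]
    congr 3
    funext i
    rw [← Complex.ofReal_mul, ← div_eq_mul_inv, Real.div_sqrt]
  refine ⟨fun j => B j * F, ?_, ?_⟩
  · have h1 : ∑ j, star (B j * F) * (B j * F) = F * ((∑ j, star (B j) * B j) * F) := by
      rw [Finset.sum_mul, Finset.mul_sum]
      exact Finset.sum_congr rfl fun j _ => by rw [star_mul, hFs]; simp only [mul_assoc]
    rw [h1, hMF, hM, sqrt_conj_diagonal hU hl, hF, conj_diagonal_mul hU, ← sub_nonneg]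
    have h2 : 1 - U * Matrix.diagonal (fun i => (((√(l i))⁻¹ : ℝ) : ℂ) * ((√(l i) : ℝ) : ℂ)) *
        star U = U * Matrix.diagonal (fun i => ((1 - (√(l i))⁻¹ * √(l i) : ℝ) : ℂ)) * star U := by
      have : (fun i => ((1 - (√(l i))⁻¹ * √(l i) : ℝ) : ℂ)) =
          fun i => 1 - (((√(l i))⁻¹ : ℝ) : ℂ) * ((√(l i) : ℝ) : ℂ) := by
        funext i; push_cast; ring
      rw [this, ← Matrix.diagonal_sub, Matrix.diagonal_one, mul_sub, sub_mul, mul_one, hU']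
    rw [h2]
    refine conj_diagonal_nonneg U fun i => ?_
    rw [sub_nonneg]
    exact inv_mul_le_one
  · rw [← hMF, Finset.sum_mul, Matrix.trace_sum]
    exact Finset.sum_congr rfl fun j _ => by rw [mul_assoc]

/-- Operator-valued Bessel inequality. -/
theorem sum_star_mul_self_le_of_orthonormal [DecidableEq ι] (e : ι → κ → ℝ)
    (he : ∀ j k, ∑ s, e j s * e k s = if j = k then 1 else 0) (H : κ → Matrix m m ℂ) :
    ∑ j, star (∑ s, (e j s : ℂ) • H s) * (∑ s, (e j s : ℂ) • H s) ≤ ∑ s, star (H s) * H s := by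
  set C : ι → Matrix m m ℂ := fun j => ∑ s, (e j s : ℂ) • H s with hCdef
  -- The defect in Bessel's inequality is the square of the residual of `H` after projection onto
  -- the span of the `e j`.
  have hexp : ∑ s, star (H s - ∑ j, (e j s : ℂ) • C j) * (H s - ∑ j, (e j s : ℂ) • C j) =
      ∑ s, star (H s) * H s - ∑ j, star (C j) * C j := by
    have h1 : ∑ s, star (H s) * (∑ j, (e j s : ℂ) • C j) = ∑ j, star (C j) * C j := by
      simp only [Finset.mul_sum]
      rw [Finset.sum_comm]
      refine Finset.sum_congr rfl fun j _ => ?_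
      rw [show star (C j) = ∑ s, (e j s : ℂ) • star (H s) by simp [hCdef, star_sum],
        Finset.sum_mul]
      exact Finset.sum_congr rfl fun s _ => by rw [mul_smul_comm, smul_mul_assoc]
    have h2 : ∑ s, star (∑ j, (e j s : ℂ) • C j) * H s = ∑ j, star (C j) * C j := by
      have := congrArg star h1
      simpa [star_sum, star_mul] using this
    have h3 : ∑ s, star (∑ j, (e j s : ℂ) • C j) * (∑ j, (e j s : ℂ) • C j) =
        ∑ j, star (C j) * C j := by
      have : ∀ s, star (∑ j, (e j s : ℂ) • C j) * (∑ j, (e j s : ℂ) • C j) =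
          ∑ j, ∑ k, ((e j s * e k s : ℝ) : ℂ) • (star (C j) * C k) := by
        intro s
        rw [star_sum, Finset.sum_mul_sum]
        refine Finset.sum_congr rfl fun j _ => Finset.sum_congr rfl fun k _ => ?_
        rw [star_smul, smul_mul_smul_comm]
        simp
      simp only [this]
      rw [Finset.sum_comm]
      refine Finset.sum_congr rfl fun j _ => ?_
      rw [Finset.sum_comm]
      simp only [← Finset.sum_smul, ← Complex.ofReal_sum, he]
      simp
    simp only [star_sub, sub_mul, mul_sub, Finset.sum_sub_distrib, h1, h2, h3]
    abel
  rw [← sub_nonneg, ← hexp]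
  exact sum_star_mul_self_nonneg _

end TraceDuality

/-! ### Pauli matrices on one qubit. -/

section Pauli

/-- The Pauli matrices `1, σ_x, σ_y, σ_z`. -/
def pauli : Fin 4 → Matrix (Fin 2) (Fin 2) ℂ :=
  ![1, !![0, 1; 1, 0], !![0, -Complex.I; Complex.I, 0], !![1, 0; 0, -1]]

theorem star_pauli (k : Fin 4) : star (pauli k) = pauli k := by
  fin_cases k <;> ext i j <;> fin_cases i <;> fin_cases j <;>
    simp [pauli, Matrix.star_apply]

theorem star_pauli_mul_self (k : Fin 4) : star (pauli k) * pauli k = 1 := by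
  fin_cases k <;> ext i j <;> fin_cases i <;> fin_cases j <;>
    simp [pauli, Matrix.mul_apply, Fin.sum_univ_two, Matrix.star_apply]

theorem pauli_mul_star_self (k : Fin 4) : pauli k * star (pauli k) = 1 :=
  mul_eq_one_comm.mp (star_pauli_mul_self k)

/-- Averaging the conjugations by the Pauli matrices gives the normalized trace. -/
theorem sum_pauli_conj (X : Matrix (Fin 2) (Fin 2) ℂ) :
    ∑ k, pauli k * X * star (pauli k) = (2 * X.trace) • (1 : Matrix (Fin 2) (Fin 2) ℂ) := by
  rw [Matrix.eta_fin_two X]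
  simp only [Fin.sum_univ_four, star_pauli]
  ext i j
  fin_cases i <;> fin_cases j <;> simp [pauli, Matrix.trace_fin_two] <;> ring_nf <;>
    try (rw [Complex.I_sq]; ring)

theorem pauli_zero : pauli 0 = 1 := rfl

theorem gen₀_apply (X : Matrix (Fin 2) (Fin 2) ℂ) :
    gen₀ X = X - (2⁻¹ * X.trace) • (1 : Matrix (Fin 2) (Fin 2) ℂ) := rfl

theorem gen₀_eq_pauli (X : Matrix (Fin 2) (Fin 2) ℂ) :
    gen₀ X = X - (4⁻¹ : ℂ) • ∑ k, pauli k * X * star (pauli k) := by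
  rw [sum_pauli_conj, gen₀_apply, smul_smul]
  congr 2
  ring

theorem gen₀_gen₀ (X : Matrix (Fin 2) (Fin 2) ℂ) : gen₀ (gen₀ X) = gen₀ X := by
  have : (gen₀ X).trace = 0 := by
    rw [gen₀_apply, Matrix.trace_sub, Matrix.trace_smul, Matrix.trace_one]
    simp
    ring
  rw [gen₀_apply (gen₀ X), this]
  simp

end Pauli

/-! ### Elementary tensors, Pauli strings and Pauli channels. -/

section Tensor

variable {n : ℕ}

theorem tensor_apply (A : Fin n → Matrix (Fin 2) (Fin 2) ℂ) (x y : Fin n → Fin 2) :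
    tensor A x y = ∏ i, A i (x i) (y i) := rfl

theorem tensor_mul (A B : Fin n → Matrix (Fin 2) (Fin 2) ℂ) :
    tensor A * tensor B = tensor fun i => A i * B i := by
  ext x y
  simp only [Matrix.mul_apply, tensor_apply, ← Finset.prod_mul_distrib]
  rw [Finset.prod_univ_sum, Fintype.piFinset_univ]

theorem star_tensor (A : Fin n → Matrix (Fin 2) (Fin 2) ℂ) :
    star (tensor A) = tensor fun i => star (A i) := by
  ext x y
  simp [Matrix.star_apply, tensor_apply]

theorem tensor_one : tensor (fun _ : Fin n => (1 : Matrix (Fin 2) (Fin 2) ℂ)) = 1 := by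
  ext x y
  rw [tensor_apply]
  simp only [Matrix.one_apply, Finset.prod_ite_zero, Finset.prod_const_one, Finset.mem_univ,
    true_imp_iff]
  simp only [funext_iff]

theorem trace_tensor (A : Fin n → Matrix (Fin 2) (Fin 2) ℂ) :
    (tensor A).trace = ∏ i, (A i).trace := by
  simp only [Matrix.trace, Matrix.diag_apply, tensor_apply]
  rw [Finset.prod_univ_sum, Fintype.piFinset_univ]

theorem tensor_smul (c : Fin n → ℂ) (A : Fin n → Matrix (Fin 2) (Fin 2) ℂ) :
    tensor (fun i => c i • A i) = (∏ i, c i) • tensor A := by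
  ext x y
  simp [tensor_apply, Finset.prod_mul_distrib]

theorem tensor_sum {κ : Type*} [Fintype κ] (A : Fin n → κ → Matrix (Fin 2) (Fin 2) ℂ) :
    tensor (fun i => ∑ k, A i k) = ∑ s : Fin n → κ, tensor fun i => A i (s i) := by
  ext x y
  simp only [tensor_apply, Matrix.sum_apply]
  rw [Finset.prod_univ_sum, Fintype.piFinset_univ]

/-- Linear maps that agree on elementary tensors are equal. -/
theorem linearMap_ext_tensor {S T : Alg n →ₗ[ℂ] Alg n}
    (h : ∀ A, S (tensor A) = T (tensor A)) : S = T := by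
  refine Matrix.ext_linearMap ℂ fun x y => LinearMap.ext_ring ?_
  have hs : (Matrix.single x y 1 : Alg n) =
      tensor fun i => Matrix.single (x i) (y i) 1 := by
    ext u v
    simp only [tensor, Matrix.of_apply, Matrix.single_apply, Finset.prod_ite_zero,
      Finset.prod_const_one, Finset.mem_univ, true_imp_iff]
    congr 1
    simp only [funext_iff, forall_and]
  change S (Matrix.single x y 1) = T (Matrix.single x y 1)
  rw [hs, h]

/-- The tensor product of Pauli matrices with labels `s`. -/
def pauliString (s : Fin n → Fin 4) : Alg n := tensor fun i => pauli (s i)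

theorem star_pauliString (s : Fin n → Fin 4) : star (pauliString s) = pauliString s := by
  simp only [pauliString, star_tensor, star_pauli]

theorem pauliString_mul_star_self (s : Fin n → Fin 4) :
    pauliString s * star (pauliString s) = 1 := by
  simp only [pauliString, star_tensor, tensor_mul, pauli_mul_star_self, tensor_one]

theorem star_pauliString_mul_self (s : Fin n → Fin 4) :
    star (pauliString s) * pauliString s = 1 :=
  mul_eq_one_comm.mp (pauliString_mul_star_self s)

/-- The Pauli matrix `σ_k` acting on the `j`-th qubit. -/
def pauliAt (j : Fin n) (k : Fin 4) : Alg n := pauliString (Function.update 0 j k)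

/-- The Pauli channel `⨂ᵢ (X ↦ ∑ₖ cᵢ(k) σₖ X σₖ⋆)`. -/
def pauliChannel (c : Fin n → Fin 4 → ℝ) : Alg n →ₗ[ℂ] Alg n :=
  ∑ s : Fin n → Fin 4, ((∏ i, c i (s i) : ℝ) : ℂ) •
    (LinearMap.mulLeft ℂ (pauliString s) ∘ₗ LinearMap.mulRight ℂ (star (pauliString s)))

theorem pauliChannel_apply (c : Fin n → Fin 4 → ℝ) (G : Alg n) :
    pauliChannel c G = ∑ s : Fin n → Fin 4, ((∏ i, c i (s i) : ℝ) : ℂ) •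
      (pauliString s * G * star (pauliString s)) := by
  simp [pauliChannel, LinearMap.sum_apply, mul_assoc]

theorem pauliString_conj_tensor (s : Fin n → Fin 4) (A : Fin n → Matrix (Fin 2) (Fin 2) ℂ) :
    pauliString s * tensor A * star (pauliString s) =
      tensor fun i => pauli (s i) * A i * star (pauli (s i)) := by
  simp only [pauliString, star_tensor, tensor_mul]

theorem pauliChannel_tensor (c : Fin n → Fin 4 → ℝ) (A : Fin n → Matrix (Fin 2) (Fin 2) ℂ) :
    pauliChannel c (tensor A) =
      tensor fun i => ∑ k, (c i k : ℂ) • (pauli k * A i * star (pauli k)) := by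
  rw [pauliChannel_apply, tensor_sum]
  refine Finset.sum_congr rfl fun s _ => ?_
  rw [pauliString_conj_tensor, tensor_smul, Complex.ofReal_prod]

theorem pauliChannel_single_zero (G : Alg n) :
    pauliChannel (fun _ => Pi.single 0 1) G = G := by
  suffices h : pauliChannel (fun _ : Fin n => Pi.single 0 1) = LinearMap.id by
    rw [h, LinearMap.id_apply]
  refine linearMap_ext_tensor fun A => ?_
  rw [pauliChannel_tensor, LinearMap.id_apply]
  congr 1
  funext i
  simp [Pi.single_apply, pauli_zero]

theorem pauliChannel_quarter (G : Alg n) :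
    pauliChannel (fun _ _ => 4⁻¹) G = ((2 ^ n : ℂ)⁻¹ * G.trace) • (1 : Alg n) := by
  let T : Alg n →ₗ[ℂ] Alg n :=
    ((2 ^ n : ℂ)⁻¹ • Matrix.traceLinearMap (Fin n → Fin 2) ℂ ℂ).smulRight (1 : Alg n)
  suffices h : pauliChannel (fun (_ : Fin n) _ => 4⁻¹) = T by
    rw [h]
    simp [T]
  refine linearMap_ext_tensor fun A => ?_
  have hA : ∀ i, ∑ k, ((4⁻¹ : ℝ) : ℂ) • (pauli k * A i * star (pauli k)) =
      (2⁻¹ * (A i).trace) • (1 : Matrix (Fin 2) (Fin 2) ℂ) := fun i => by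
    rw [← Finset.smul_sum, sum_pauli_conj, smul_smul]
    congr 1
    push_cast
    ring
  simp only [pauliChannel_tensor, hA]
  rw [tensor_smul, tensor_one, Finset.prod_mul_distrib, ← trace_tensor]
  simp [T]

/-- If the `j`-th weight has total mass zero and is constant away from `0`, the channel maps into
the range of `d j`. -/
theorem d_pauliChannel (c : Fin n → Fin 4 → ℝ) (j : Fin n) (a : ℝ)
    (hc : c j = fun k => a * (4⁻¹ - (Pi.single 0 1 : Fin 4 → ℝ) k)) (G : Alg n) :
    d j (pauliChannel c G) = pauliChannel c G := by
  suffices h : d j ∘ₗ pauliChannel c = pauliChannel c by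
    exact LinearMap.congr_fun h G
  refine linearMap_ext_tensor fun A => ?_
  rw [LinearMap.comp_apply, pauliChannel_tensor, d_tensor]
  congr 1
  -- Such weights make the `j`-th factor a multiple of `gen₀`, which is idempotent.
  have hloc : ∑ k, (c j k : ℂ) • (pauli k * A j * star (pauli k)) = -(a : ℂ) • gen₀ (A j) := by
    rw [gen₀_eq_pauli, hc]
    simp [Fin.sum_univ_four, Pi.single_apply, pauli_zero]
    module
  have h2 : gen₀ (∑ k, (c j k : ℂ) • (pauli k * A j * star (pauli k))) =
      ∑ k, (c j k : ℂ) • (pauli k * A j * star (pauli k)) := by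
    rw [hloc, map_smul, gen₀_gen₀]
  rw [h2]
  exact Function.update_eq_self j
    (fun i => ∑ k, (c i k : ℂ) • (pauli k * A i * star (pauli k)))

/-- Writing `d j` through unitary conjugations makes its symmetry and the sum-of-squares form of `Γ`
algebraic. -/
theorem d_apply_eq_pauliAt (j : Fin n) (G : Alg n) :
    d j G = G - (4⁻¹ : ℂ) • ∑ k, pauliAt j k * G * star (pauliAt j k) := by
  let T : Alg n →ₗ[ℂ] Alg n := LinearMap.id - (4⁻¹ : ℂ) • ∑ k,
    (LinearMap.mulLeft ℂ (pauliAt j k) ∘ₗ LinearMap.mulRight ℂ (star (pauliAt j k)))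
  have hT : ∀ G, T G = G - (4⁻¹ : ℂ) • ∑ k, pauliAt j k * G * star (pauliAt j k) := fun G => by
    simp [T, LinearMap.sum_apply, mul_assoc]
  rw [← hT]
  suffices h : d j = T by rw [h]
  refine linearMap_ext_tensor fun A => ?_
  have hu : ∀ k, pauliAt j k * tensor A * star (pauliAt j k) =
      tensor (Function.update A j (pauli k * A j * star (pauli k))) := fun k => by
    rw [pauliAt, pauliString_conj_tensor]
    congr 1
    funext i
    rcases eq_or_ne i j with rfl | hij
    · simp
    · simp [Function.update_of_ne hij, pauli_zero]
  have hlin : ∀ (X : Matrix (Fin 2) (Fin 2) ℂ) (x y : Fin n → Fin 2),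
      tensor (Function.update A j X) x y =
        X (x j) (y j) * ∏ i ∈ Finset.univ.erase j, A i (x i) (y i) := fun X x y => by
    rw [tensor_apply, ← Finset.mul_prod_erase _ _ (Finset.mem_univ j), Function.update_self]
    congr 1
    exact Finset.prod_congr rfl fun i hi => by
      rw [Function.update_of_ne (Finset.ne_of_mem_erase hi)]
  rw [hT, d_tensor]
  simp only [hu]
  ext x y
  have hA : tensor A x y = A j (x j) (y j) * ∏ i ∈ Finset.univ.erase j, A i (x i) (y i) := by
    rw [← hlin, Function.update_eq_self]
  simp only [Matrix.sub_apply, Matrix.smul_apply, Matrix.sum_apply, hlin, hA, gen₀_eq_pauli,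
    smul_eq_mul, ← Finset.sum_mul]
  ring

end Tensor

variable {n : ℕ}

theorem star_d (j : Fin n) (A : Alg n) : star (d j A) = d j (star A) := by
  simp only [d_apply_eq_pauliAt, star_sub, star_smul, star_sum, star_mul, star_star, mul_assoc]
  simp

/-- `d j` is self-adjoint for the trace inner product. -/
theorem trace_star_mul_d (j : Fin n) (A Y : Alg n) :
    (star A * d j Y).trace = (star (d j A) * Y).trace := by
  have hk : ∀ k, (star A * (pauliAt j k * Y * star (pauliAt j k))).trace =
      (pauliAt j k * star A * star (pauliAt j k) * Y).trace := fun k => by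
    have hs : star (pauliAt j k) = pauliAt j k := star_pauliString _
    rw [hs, ← mul_assoc, Matrix.trace_mul_comm]
    simp only [mul_assoc]
  rw [star_d]
  simp only [d_apply_eq_pauliAt, mul_sub, sub_mul, mul_smul_comm, smul_mul_assoc,
    Matrix.trace_sub, Matrix.trace_smul, Finset.mul_sum, Finset.sum_mul, Matrix.trace_sum, hk]

/-! ### Positivity of the carré du champ and its bound from below. -/

section CarreDuChamp

/-- The `j`-th summand of `2 Γ(A)` as an average of squares. -/
theorem carreDuChamp_summand (j : Fin n) (A : Alg n) :
    d j (star A) * A + star A * d j A - d j (star A * A) =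
      (4⁻¹ : ℂ) • ∑ k, star (A - pauliAt j k * A * star (pauliAt j k)) *
        (A - pauliAt j k * A * star (pauliAt j k)) := by
  have hk : ∀ k, star (A - pauliAt j k * A * star (pauliAt j k)) *
      (A - pauliAt j k * A * star (pauliAt j k)) =
      star A * A - pauliAt j k * star A * star (pauliAt j k) * A
        - star A * (pauliAt j k * A * star (pauliAt j k))
        + pauliAt j k * (star A * A) * star (pauliAt j k) := fun k => by
    have h1 : star (pauliAt j k) * pauliAt j k = 1 := star_pauliString_mul_self _
    have h2 : pauliAt j k * star A * star (pauliAt j k) *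
        (pauliAt j k * A * star (pauliAt j k)) =
        pauliAt j k * (star A * A) * star (pauliAt j k) := by
      calc _ = pauliAt j k * star A * (star (pauliAt j k) * pauliAt j k) * A *
            star (pauliAt j k) := by simp only [mul_assoc]
        _ = _ := by rw [h1, mul_one]; simp only [mul_assoc]
    rw [← h2]
    simp only [star_sub, star_mul, star_star, mul_sub, sub_mul, mul_assoc]
    abel
  simp only [hk, d_apply_eq_pauliAt, Finset.sum_add_distrib, Finset.sum_sub_distrib,
    Finset.sum_const, Finset.card_univ, Fintype.card_fin, sub_mul, mul_sub, Finset.sum_mul,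
    Finset.mul_sum, smul_mul_assoc, mul_smul_comm]
  module

theorem star_d_mul_d_le (j : Fin n) (A : Alg n) :
    star (d j A) * d j A ≤ d j (star A) * A + star A * d j A - d j (star A * A) := by
  rw [carreDuChamp_summand]
  -- Bessel with the single unit vector `(½, ½, ½, ½)`; the other `½`, put into `H`, completes the
  -- averaging factor `¼`.
  have h := sum_star_mul_self_le_of_orthonormal (ι := Unit) (fun _ (_ : Fin 4) => (2⁻¹ : ℝ))
    (fun _ _ => by simp; norm_num)
    (fun k => (2⁻¹ : ℂ) • (A - pauliAt j k * A * star (pauliAt j k)))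
  have hd : ∑ k : Fin 4, ((2⁻¹ : ℝ) : ℂ) •
      ((2⁻¹ : ℂ) • (A - pauliAt j k * A * star (pauliAt j k))) = d j A := by
    rw [d_apply_eq_pauliAt, ← Finset.smul_sum, ← Finset.smul_sum, Finset.sum_sub_distrib,
      Finset.sum_const, Finset.card_univ, Fintype.card_fin]
    push_cast
    module
  simp only [hd, Finset.univ_unique, Finset.sum_singleton] at h
  refine h.trans_eq ?_
  rw [Finset.smul_sum]
  refine Finset.sum_congr rfl fun k _ => ?_
  rw [star_smul, smul_mul_smul_comm]
  congr 1
  simp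
  norm_num

theorem two_smul_carreDuChamp (A : Alg n) :
    (2 : ℂ) • carreDuChamp A =
      ∑ j, (d j (star A) * A + star A * d j A - d j (star A * A)) := by
  simp only [carreDuChamp, gen, LinearMap.sum_apply, Finset.sum_mul, Finset.mul_sum,
    Finset.sum_add_distrib, Finset.sum_sub_distrib]
  rw [smul_smul]
  norm_num

theorem sum_star_d_mul_d_le (A : Alg n) :
    ∑ j, star (d j A) * d j A ≤ (2 : ℂ) • carreDuChamp A := by
  rw [two_smul_carreDuChamp]
  exact Finset.sum_le_sum fun j _ => star_d_mul_d_le j A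

theorem carreDuChamp_posSemidef (A : Alg n) : (carreDuChamp A).PosSemidef := by
  have h := Matrix.nonneg_iff_posSemidef.mp
    ((sum_star_mul_self_nonneg fun j => d j A).trans (sum_star_d_mul_d_le A))
  have h2 := h.smul (show (0 : ℂ) ≤ 2⁻¹ by positivity)
  rwa [smul_smul, inv_mul_cancel₀ two_ne_zero, one_smul] at h2

end CarreDuChamp

/-! ### Trace-norm comparisons. -/

section Norm

theorem norm₁_of_nonneg {A : Alg n} (hA : 0 ≤ A) : norm₁ A = (2 ^ n : ℝ)⁻¹ * A.trace.re := by
  rw [norm₁, hA.isSelfAdjoint.star_eq, CFC.sqrt_mul_self A hA]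

theorem norm₁_sqrt (M : Alg n) :
    norm₁ (CFC.sqrt M) = (2 ^ n : ℝ)⁻¹ * (CFC.sqrt M).trace.re :=
  norm₁_of_nonneg (CFC.sqrt_nonneg M)

theorem norm₁_nonneg (A : Alg n) : 0 ≤ norm₁ A := by
  have := (Matrix.nonneg_iff_posSemidef.mp (CFC.sqrt_nonneg (star A * A))).trace_nonneg
  exact mul_nonneg (by positivity) (Complex.le_def.mp this).1

theorem trace_re_mono {S T : Alg n} (h : S ≤ T) : S.trace.re ≤ T.trace.re := by
  have := (Complex.le_def.mp (Matrix.le_iff.mp h).trace_nonneg).1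
  rw [Matrix.trace_sub, Complex.sub_re, Complex.zero_re] at this
  linarith

theorem norm₁_sqrt_mono {S T : Alg n} (h : S ≤ T) :
    norm₁ (CFC.sqrt S) ≤ norm₁ (CFC.sqrt T) := by
  -- Operator monotonicity of the square root is a C⋆-algebra fact, hence the operator norm.
  have hs : CFC.sqrt S ≤ CFC.sqrt T := by
    open scoped Matrix.Norms.L2Operator in
    exact CFC.sqrt_le_sqrt S T h
  rw [norm₁_sqrt, norm₁_sqrt]
  exact mul_le_mul_of_nonneg_left (trace_re_mono hs) (by positivity)

theorem norm₁_sqrt_two_smul {M : Alg n} (hM : 0 ≤ M) :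
    norm₁ (CFC.sqrt ((2 : ℂ) • M)) = √2 * norm₁ (CFC.sqrt M) := by
  have hs : CFC.sqrt ((2 : ℂ) • M) = ((√2 : ℝ) : ℂ) • CFC.sqrt M := by
    refine CFC.sqrt_unique ?_ ?_
    · rw [smul_mul_smul_comm, CFC.sqrt_mul_sqrt_self M hM, ← Complex.ofReal_mul,
        Real.mul_self_sqrt zero_le_two]
      norm_num
    · rw [Matrix.nonneg_iff_posSemidef]
      refine (Matrix.nonneg_iff_posSemidef.mp (CFC.sqrt_nonneg M)).smul ?_
      exact_mod_cast Real.sqrt_nonneg 2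
  rw [norm₁_sqrt, norm₁_sqrt, hs, Matrix.trace_smul, smul_eq_mul, Complex.re_ofReal_mul]
  ring

theorem norm₁_squareFun_le_carreDuChamp (A : Alg n) :
    norm₁ (squareFun A) ≤ √2 * norm₁ (CFC.sqrt (carreDuChamp A)) := by
  rw [← norm₁_sqrt_two_smul (Matrix.nonneg_iff_posSemidef.mpr (carreDuChamp_posSemidef A))]
  exact norm₁_sqrt_mono (sum_star_d_mul_d_le A)

/-- Each entry of an optimal dual column is itself a contraction, so its pairing with `d j A` costs
at most the trace norm of `d j A`. -/
theorem norm₁_squareFun_le_totalInfluence₁ (A : Alg n) :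
    norm₁ (squareFun A) ≤ totalInfluence₁ A := by
  obtain ⟨C, hC, hCtr⟩ := exists_sum_trace_eq fun j => d j A
  simp only [squareFun, norm₁_sqrt, totalInfluence₁]
  simp only [norm₁, ← Finset.mul_sum]
  gcongr
  rw [← hCtr, Complex.re_sum]
  refine Finset.sum_le_sum fun j _ => (Complex.re_le_norm _).trans ?_
  have hj : star (C j) * C j ≤ 1 := (Finset.single_le_sum
    (fun k _ => star_mul_self_nonneg (C k)) (Finset.mem_univ j)).trans hC
  simpa using norm_sum_trace_le (ι := Unit) (fun _ => d j A) (fun _ => C j) (by simpa using hj)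

end Norm

/-! ### Interpolation between the identity and the normalized trace. -/

section Interpolation

/-- Amplitudes of the depolarizing channel: `cos t` on the identity and `sin t / √3` on each of
the other Pauli matrices. -/
def amp (t : ℝ) (k : Fin 4) : ℝ := if k = 0 then Real.cos t else Real.sin t / √3

/-- The derivative of `amp`. -/
def ampDeriv (t : ℝ) (k : Fin 4) : ℝ := if k = 0 then -Real.sin t else Real.cos t / √3

theorem hasDerivAt_amp (t : ℝ) (k : Fin 4) :
    HasDerivAt (fun t => amp t k) (ampDeriv t k) t := by
  by_cases hk : k = 0
  · simpa [amp, ampDeriv, hk] using Real.hasDerivAt_cos t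
  · simpa [amp, ampDeriv, hk] using (Real.hasDerivAt_sin t).div_const √3

/-- The curve `amp` is a unit-speed great circle in `ℝ⁴`; this and the next two lemmas give the
orthonormality used in Bessel's inequality. -/
theorem sum_amp_mul_amp (t : ℝ) : ∑ k, amp t k * amp t k = 1 := by
  have h3 : √3 * √3 = (3 : ℝ) := Real.mul_self_sqrt (by norm_num)
  simp [Fin.sum_univ_four, amp, div_mul_div_comm, h3]
  linarith [Real.sin_sq_add_cos_sq t]

theorem sum_ampDeriv_mul_ampDeriv (t : ℝ) : ∑ k, ampDeriv t k * ampDeriv t k = 1 := by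
  have h3 : √3 * √3 = (3 : ℝ) := Real.mul_self_sqrt (by norm_num)
  simp [Fin.sum_univ_four, ampDeriv, div_mul_div_comm, h3]
  linarith [Real.sin_sq_add_cos_sq t]

theorem sum_ampDeriv_mul_amp (t : ℝ) : ∑ k, ampDeriv t k * amp t k = 0 := by
  have h3 : √3 * √3 = (3 : ℝ) := Real.mul_self_sqrt (by norm_num)
  simp [Fin.sum_univ_four, amp, ampDeriv, div_mul_div_comm, h3]
  ring

/-- This is the form of weight required by `d_pauliChannel`. -/
theorem amp_mul_ampDeriv (t : ℝ) (k : Fin 4) :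
    amp t k * ampDeriv t k =
      (4 / 3 * (Real.cos t * Real.sin t)) * (4⁻¹ - (Pi.single 0 1 : Fin 4 → ℝ) k) := by
  have h3 : √3 * √3 = (3 : ℝ) := Real.mul_self_sqrt (by norm_num)
  by_cases hk : k = 0
  · simp [amp, ampDeriv, hk]
    ring
  · simp [amp, ampDeriv, hk, div_mul_div_comm, h3]
    ring

/-- The amplitudes on `n` qubits, differentiated in the `j`-th factor. -/
def ampFactor (t : ℝ) (j i : Fin n) : Fin 4 → ℝ := if i = j then ampDeriv t else amp t

theorem sum_pi_prod_mul_prod (f g : Fin n → Fin 4 → ℝ) :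
    ∑ s : Fin n → Fin 4, (∏ i, f i (s i)) * ∏ i, g i (s i) = ∏ i, ∑ k, f i k * g i k := by
  rw [Finset.prod_univ_sum, Fintype.piFinset_univ]
  simp only [Finset.prod_mul_distrib]

/-- For `j ≠ k` the `j`-th factor pairs `ampDeriv t` with `amp t`, which kills the product. -/
theorem ampFactor_orthonormal (t : ℝ) (j k : Fin n) :
    ∑ s : Fin n → Fin 4, (∏ i, ampFactor t j i (s i)) * ∏ i, ampFactor t k i (s i) =
      if j = k then 1 else 0 := by
  rw [sum_pi_prod_mul_prod]
  split_ifs with h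
  · subst h
    refine Finset.prod_eq_one fun i _ => ?_
    by_cases hij : i = j
    · simp only [ampFactor, if_pos hij, sum_ampDeriv_mul_ampDeriv]
    · simp only [ampFactor, if_neg hij, sum_amp_mul_amp]
  · refine Finset.prod_eq_zero (Finset.mem_univ j) ?_
    simp only [ampFactor, if_pos, if_neg h, sum_ampDeriv_mul_amp]

/-- The partial derivatives of the depolarizing channel form a column contraction. -/
theorem sum_star_pauliChannel_mul_le (t : ℝ) {G : Alg n} (hG : star G * G ≤ 1) :
    ∑ j, star (pauliChannel (fun i k => amp t k * ampFactor t j i k) G) *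
      pauliChannel (fun i k => amp t k * ampFactor t j i k) G ≤ 1 := by
  -- Each weight splits into `ampFactor`, the orthonormal part, and `amp`, absorbed into `H`; then
  -- `∑ star (H s) * H s` is at most `1` as the squared amplitudes sum to `1`.
  have h := sum_star_mul_self_le_of_orthonormal
    (fun (j : Fin n) (s : Fin n → Fin 4) => ∏ i, ampFactor t j i (s i))
    (ampFactor_orthonormal t)
    (fun s => ((∏ i, amp t (s i) : ℝ) : ℂ) • (pauliString s * G * star (pauliString s)))
  have hch : ∀ j : Fin n, pauliChannel (fun i k => amp t k * ampFactor t j i k) G =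
      ∑ s : Fin n → Fin 4, ((∏ i, ampFactor t j i (s i) : ℝ) : ℂ) •
        ((∏ i, amp t (s i) : ℝ) : ℂ) • (pauliString s * G * star (pauliString s)) := fun j => by
    rw [pauliChannel_apply]
    refine Finset.sum_congr rfl fun s _ => ?_
    rw [smul_smul, ← Complex.ofReal_mul, Finset.prod_mul_distrib, mul_comm]
  simp only [hch]
  refine h.trans ?_
  have hU : ∀ s : Fin n → Fin 4, star (pauliString s * G * star (pauliString s)) *
      (pauliString s * G * star (pauliString s)) ≤ 1 := fun s => by
    have h1 : star (pauliString s * G * star (pauliString s)) *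
        (pauliString s * G * star (pauliString s)) =
        pauliString s * (star G * G) * star (pauliString s) := by
      calc _ = pauliString s * star G * (star (pauliString s) * pauliString s) * G *
            star (pauliString s) := by simp only [star_mul, star_star, mul_assoc]
        _ = _ := by rw [star_pauliString_mul_self, mul_one]; simp only [mul_assoc]
    rw [h1]
    refine (star_right_conjugate_le_conjugate hG (pauliString s)).trans_eq ?_
    rw [mul_one, pauliString_mul_star_self]
  calc _ ≤ ∑ s : Fin n → Fin 4,
        (((∏ i, amp t (s i)) * ∏ i, amp t (s i) : ℝ) : ℂ) • (1 : Alg n) := by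
        refine Finset.sum_le_sum fun s _ => ?_
        rw [star_smul, smul_mul_smul_comm]
        have h0 : (0 : ℂ) ≤ (((∏ i, amp t (s i)) * ∏ i, amp t (s i) : ℝ) : ℂ) := by
          exact_mod_cast mul_self_nonneg _
        have := (Matrix.le_iff.mp (hU s)).smul h0
        rw [smul_sub] at this
        refine Matrix.le_iff.mpr ?_
        convert this using 3
        simp
    _ = 1 := by
        rw [← Finset.sum_smul, ← Complex.ofReal_sum,
          sum_pi_prod_mul_prod (fun _ => amp t) fun _ => amp t]
        simp only [sum_amp_mul_amp, Finset.prod_const_one, Complex.ofReal_one, one_smul]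

theorem hasDerivAt_prod_amp_sq (t : ℝ) (s : Fin n → Fin 4) :
    HasDerivAt (fun t => ∏ i, amp t (s i) * amp t (s i))
      (∑ j, 2 * ∏ i, amp t (s i) * ampFactor t j i (s i)) t := by
  have h := HasDerivAt.fun_finsetProd (u := Finset.univ) fun i _ =>
    (hasDerivAt_amp t (s i)).fun_mul (hasDerivAt_amp t (s i))
  refine h.congr_deriv (Finset.sum_congr rfl fun j _ => ?_)
  rw [← Finset.mul_prod_erase _ (fun i => amp t (s i) * ampFactor t j i (s i))
    (Finset.mem_univ j)]
  have he : ∏ i ∈ Finset.univ.erase j, amp t (s i) * ampFactor t j i (s i) =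
      ∏ i ∈ Finset.univ.erase j, amp t (s i) * amp t (s i) :=
    Finset.prod_congr rfl fun i hi => by
      rw [ampFactor, if_neg (Finset.ne_of_mem_erase hi)]
  rw [he, ampFactor, if_pos rfl, smul_eq_mul]
  ring

theorem trace_star_mul_pauliChannel (c : Fin n → Fin 4 → ℝ) (A G : Alg n) :
    (star A * pauliChannel c G).trace = ∑ s : Fin n → Fin 4, ((∏ i, c i (s i) : ℝ) : ℂ) *
      (star A * (pauliString s * G * star (pauliString s))).trace := by
  simp only [pauliChannel_apply, Finset.mul_sum, Matrix.trace_sum, mul_smul_comm,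
    Matrix.trace_smul, smul_eq_mul]

theorem hasDerivAt_trace_pauliChannel (t : ℝ) (A G : Alg n) :
    HasDerivAt (fun t => (star A * pauliChannel (fun _ k => amp t k * amp t k) G).trace)
      (2 * ∑ j, (star (d j A) *
        pauliChannel (fun i k => amp t k * ampFactor t j i k) G).trace) t := by
  simp only [trace_star_mul_pauliChannel (fun _ k => amp _ k * amp _ k)]
  have h := HasDerivAt.fun_sum (u := Finset.univ) fun (s : Fin n → Fin 4) _ =>
    (hasDerivAt_prod_amp_sq t s).ofReal_comp.mul_const
      (star A * (pauliString s * G * star (pauliString s))).trace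
  refine h.congr_deriv ?_
  -- The `j`-th derivative channel is fixed by `d j`, which then moves to `A` by self-adjointness.
  have hd : ∀ j : Fin n, (star (d j A) *
      pauliChannel (fun i k => amp t k * ampFactor t j i k) G).trace =
      (star A * pauliChannel (fun i k => amp t k * ampFactor t j i k) G).trace := fun j => by
    rw [← trace_star_mul_d, d_pauliChannel _ j (4 / 3 * (Real.cos t * Real.sin t))]
    funext k
    rw [ampFactor, if_pos rfl, amp_mul_ampDeriv]
  simp only [hd, trace_star_mul_pauliChannel, Complex.ofReal_sum, Complex.ofReal_mul,
    Finset.sum_mul, Finset.mul_sum]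
  rw [Finset.sum_comm]
  refine Finset.sum_congr rfl fun j _ => Finset.sum_congr rfl fun s _ => ?_
  push_cast
  ring

theorem pauliChannel_amp_zero (G : Alg n) :
    pauliChannel (fun _ k => amp 0 k * amp 0 k) G = G := by
  conv_rhs => rw [← pauliChannel_single_zero G]
  congr 2
  funext _ k
  by_cases hk : k = 0 <;> simp [amp, hk]

/-- At `π/3` all four weights agree: `cos² = ¼` and `sin² / 3 = ¼`. -/
theorem pauliChannel_amp_pi_div_three (G : Alg n) :
    pauliChannel (fun _ k => amp (Real.pi / 3) k * amp (Real.pi / 3) k) G =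
      ((2 ^ n : ℂ)⁻¹ * G.trace) • (1 : Alg n) := by
  rw [← pauliChannel_quarter G]
  congr 2
  funext _ k
  have h3 : √3 * √3 = (3 : ℝ) := Real.mul_self_sqrt (by norm_num)
  by_cases hk : k = 0
  · simp [amp, hk]
    norm_num
  · simp only [amp, hk, if_false, Real.sin_pi_div_three]
    field_simp
    norm_num

theorem norm_trace_star_mul_sub_le (A : Alg n) {G : Alg n} (hG : star G * G ≤ 1) :
    ‖(star A * (G - ((2 ^ n : ℂ)⁻¹ * G.trace) • (1 : Alg n))).trace‖ ≤
      2 * (CFC.sqrt (∑ j, star (d j A) * d j A)).trace.re * (Real.pi / 3) := by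
  have hb : ∀ t : ℝ, ‖(2 * ∑ j, (star (d j A) *
      pauliChannel (fun i k => amp t k * ampFactor t j i k) G).trace : ℂ)‖ ≤
      2 * (CFC.sqrt (∑ j, star (d j A) * d j A)).trace.re := fun t => by
    rw [norm_mul, Complex.norm_ofNat]
    gcongr
    exact norm_sum_trace_le _ _ (sum_star_pauliChannel_mul_le t hG)
  -- Mean value inequality between the two endpoints of the interpolation.
  have h := convex_univ.norm_image_sub_le_of_norm_hasDerivWithin_le (x := Real.pi / 3) (y := 0)
    (fun t _ => (hasDerivAt_trace_pauliChannel t A G).hasDerivWithinAt)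
    (fun t _ => hb t) (Set.mem_univ _) (Set.mem_univ _)
  rw [pauliChannel_amp_zero, pauliChannel_amp_pi_div_three, ← Matrix.trace_sub, ← mul_sub,
    zero_sub, norm_neg, Real.norm_of_nonneg (by positivity)] at h
  exact h

/-- The `L¹`-Poincaré inequality for the square function. -/
theorem norm₁_sub_le_squareFun (A : Alg n) :
    norm₁ (A - ((2 ^ n : ℂ)⁻¹ * A.trace) • (1 : Alg n)) ≤
      2 * Real.pi / 3 * norm₁ (squareFun A) := by
  obtain ⟨C, hC, hCtr⟩ := exists_sum_trace_eq
    fun _ : Unit => A - ((2 ^ n : ℂ)⁻¹ * A.trace) • (1 : Alg n)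
  simp only [Finset.univ_unique, Finset.sum_singleton] at hC hCtr
  set G := C default
  -- Removing the normalized trace is self-adjoint, so it passes from `A` to the dual contraction
  -- `G`.
  have hswap : (star (A - ((2 ^ n : ℂ)⁻¹ * A.trace) • (1 : Alg n)) * G).trace =
      (star A * (G - ((2 ^ n : ℂ)⁻¹ * G.trace) • (1 : Alg n))).trace := by
    have hA : (star A).trace = star A.trace := Matrix.trace_conjTranspose A
    simp only [star_sub, star_smul, star_one, sub_mul, mul_sub, smul_mul_assoc, one_mul,
      mul_smul_comm, mul_one, Matrix.trace_sub, Matrix.trace_smul, hA, smul_eq_mul]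
    simp
    ring
  rw [squareFun, norm₁_sqrt, norm₁, ← hCtr, hswap]
  have h := (Complex.re_le_norm _).trans (norm_trace_star_mul_sub_le A hC)
  calc _ ≤ (2 ^ n : ℝ)⁻¹ *
        (2 * (CFC.sqrt (∑ j, star (d j A) * d j A)).trace.re * (Real.pi / 3)) := by gcongr
    _ = _ := by ring

end Interpolation

end QubitAlgebra

end

theorem mainTheorem10 (n : ℕ) (A : QubitAlgebra.Alg n) :
    (QubitAlgebra.carreDuChamp A).PosSemidef ∧
    QubitAlgebra.norm₁ (A - ((2 ^ n : ℂ)⁻¹ * A.trace) • (1 : QubitAlgebra.Alg n)) ≤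
      Real.pi * QubitAlgebra.norm₁ (QubitAlgebra.squareFun A) ∧
    Real.pi * QubitAlgebra.norm₁ (QubitAlgebra.squareFun A) ≤
      √2 * Real.pi * QubitAlgebra.norm₁ (CFC.sqrt (QubitAlgebra.carreDuChamp A)) ∧
    Real.pi * QubitAlgebra.norm₁ (QubitAlgebra.squareFun A) ≤
      Real.pi * QubitAlgebra.totalInfluence₁ A := by
  refine ⟨QubitAlgebra.carreDuChamp_posSemidef A, ?_, ?_, ?_⟩
  · refine (QubitAlgebra.norm₁_sub_le_squareFun A).trans ?_
    refine mul_le_mul_of_nonneg_right ?_ (QubitAlgebra.norm₁_nonneg _)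
    -- The interpolation yields `2π/3`, better than the stated `π`.
    linarith [Real.pi_pos]
  · rw [mul_comm √2, mul_assoc]
    exact mul_le_mul_of_nonneg_left (QubitAlgebra.norm₁_squareFun_le_carreDuChamp A)
      Real.pi_pos.le
  · exact mul_le_mul_of_nonneg_left (QubitAlgebra.norm₁_squareFun_le_totalInfluence₁ A)
      Real.pi_pos.le
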